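/- Let $n\ge 0$, let $\lambda$ be a partition of $n$, and fix an ordering $b_1,\ldots,b_n$ of the boxes of its Young diagram. Let $S_n$ act diagonally on $\mathbb{C}[\mathbf{x},\mathbf{y}]=\mathbb{C}[x_1,\ldots,x_n,y_1,\ldots,y_n]$, so that $\pi x_i=x_{\pi(i)}$ and $\pi y_i=y_{\pi(i)}$, and extend this action linearly to the group algebra $\mathbb{C}[S_n]$. For a filling $T$ of the boxes of $\lambda$ with $1,\ldots,n$, each used once, let $C(T)$ and $R(T)$ be the subgroups of $S_n$ of the permutations that send every letter to a letter in the same column of $T$, respectively in the same row of $T$, and let $$\varepsilon_T=\sum_{\tau\in C(T)}\sum_{\sigma\in R(T)}\mathrm{sgn}(\tau)\,\tau\sigma .$$ For tuples $c=(c_1,\ldots,c_n)$ and $d=(d_1,\ldots,d_n)$ of nonnegative integers put $$F_T^{c,d}=\varepsilon_T\Big(\prod_{k=1}^n x_{T(b_k)}^{c_k}\,y_{T(b_k)}^{d_k}\Big).$$ Let $\mathrm{SYT}(\lambda)$ be the set of standard Young tableaux of shape $\lambda$, and let $I\subseteq\mathbb{C}[\mathbf{x},\mathbf{y}]$ be an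 ideal with $\pi I\subseteq I$ for all $\pi\in S_n$. Then the family of the images of the polynomials $F_T^{c,d}$, $T\in\mathrm{SYT}(\lambda)$, is linearly independent over $\mathbb{C}$ in $\mathbb{C}[\mathbf{x},\mathbf{y}]/I$ if and only if there is a $T\in\mathrm{SYT}(\lambda)$ for which $F_T^{c,d}$ is nonzero in the quotient, that is, $F_T^{c,d}\notin I$. -/

import Mathlib

open MvPolynomial

namespace HigherSpecht

/-- The polynomial ring `ℂ[x₁,…,xₙ,y₁,…,yₙ]`: the variable `xᵢ` is `X (Sum.inl i)` and the
variable `yᵢ` is `X (Sum.inr i)`. -/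
abbrev PolyXY (n : ℕ) : Type := MvPolynomial (Fin n ⊕ Fin n) ℂ

/-- The diagonal action of `Sₙ` on `ℂ[x,y]`: `π` sends `xᵢ` to `x_{π(i)}` and `yᵢ` to `y_{π(i)}`,
that is, `π f = f(x_{π(1)},…,x_{π(n)},y_{π(1)},…,y_{π(n)})`. -/
noncomputable def diagonalAction (n : ℕ) :
    Representation ℂ (Equiv.Perm (Fin n)) (PolyXY n) where
  toFun π := (rename (Sum.map π π)).toLinearMap
  map_one' := by
    apply LinearMap.ext
    intro f
    have h : (Sum.map (1 : Equiv.Perm (Fin n)) (1 : Equiv.Perm (Fin n)) :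
        Fin n ⊕ Fin n → Fin n ⊕ Fin n) = id := by
      funext v
      cases v <;> rfl
    change rename _ f = f
    rw [h, rename_id_apply]
  map_mul' π σ := by
    apply LinearMap.ext
    intro f
    have h : (Sum.map (π * σ : Equiv.Perm (Fin n)) (π * σ : Equiv.Perm (Fin n)) :
        Fin n ⊕ Fin n → Fin n ⊕ Fin n) = Sum.map π π ∘ Sum.map σ σ := by
      funext v
      cases v <;> rfl
    change rename _ f = rename _ (rename _ f)
    rw [h, rename_rename]

/-- `Tab(lam)`: the fillings of the boxes of the Young diagram `lam` with the `n` letters, each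
used exactly once. A box is a pair (row index, column index), and row `0` is the longest row. The
letters `1,…,n` are represented by the elements of `Fin n` in their order. -/
abbrev Tableau (lam : YoungDiagram) (n : ℕ) : Type := lam.cells ≃ Fin n

namespace Tableau

variable {lam : YoungDiagram} {n : ℕ}

/-- The row of `T` in which the letter `i` occurs. -/
def rowOf (T : Tableau lam n) (i : Fin n) : ℕ := (T.symm i : ℕ × ℕ).1

/-- The column of `T` in which the letter `i` occurs. -/
def colOf (T : Tableau lam n) (i : Fin n) : ℕ := (T.symm i : ℕ × ℕ).2

/-- `T` is standard: its entries increase along every row (as the column index grows) and along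
every column (as the row index grows). -/
def IsStandard (T : Tableau lam n) : Prop :=
  (∀ b b' : lam.cells, (b : ℕ × ℕ).1 = (b' : ℕ × ℕ).1 → (b : ℕ × ℕ).2 < (b' : ℕ × ℕ).2 →
    T b < T b') ∧
  (∀ b b' : lam.cells, (b : ℕ × ℕ).2 = (b' : ℕ × ℕ).2 → (b : ℕ × ℕ).1 < (b' : ℕ × ℕ).1 →
    T b < T b')

/-- `R(T)`: the permutations that send every letter to a letter in the same row of `T`. -/
def rowGroup (T : Tableau lam n) : Subgroup (Equiv.Perm (Fin n)) where
  carrier := {σ | ∀ i, T.rowOf (σ i) = T.rowOf i}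
  mul_mem' {σ τ} hσ hτ i := (hσ (τ i)).trans (hτ i)
  one_mem' _ := rfl
  inv_mem' {σ} hσ i := by
    have h := hσ (σ⁻¹ i)
    rw [show σ (σ⁻¹ i) = i from σ.apply_symm_apply i] at h
    exact h.symm

/-- `C(T)`: the permutations that send every letter to a letter in the same column of `T`. -/
def colGroup (T : Tableau lam n) : Subgroup (Equiv.Perm (Fin n)) where
  carrier := {σ | ∀ i, T.colOf (σ i) = T.colOf i}
  mul_mem' {σ τ} hσ hτ i := (hσ (τ i)).trans (hτ i)
  one_mem' _ := rfl
  inv_mem' {σ} hσ i := by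
    have h := hσ (σ⁻¹ i)
    rw [show σ (σ⁻¹ i) = i from σ.apply_symm_apply i] at h
    exact h.symm

open Classical in
/-- The Young symmetrizer `ε_T = ∑_{τ ∈ C(T)} ∑_{σ ∈ R(T)} sgn(τ) τ σ` in the group algebra. -/
noncomputable def youngSymmetrizer (T : Tableau lam n) :
    MonoidAlgebra ℂ (Equiv.Perm (Fin n)) :=
  ∑ τ : T.colGroup, ∑ σ : T.rowGroup,
    MonoidAlgebra.single ((τ : Equiv.Perm (Fin n)) * (σ : Equiv.Perm (Fin n)))
      (((Equiv.Perm.sign (τ : Equiv.Perm (Fin n)) : ℤˣ) : ℤ) : ℂ)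

/-- The monomial `x_T^c y_T^d = ∏ₖ x_{Tₖ}^{cₖ} y_{Tₖ}^{dₖ}`, where `Tₖ` is the letter of `T` in the
`k`-th box with respect to the ordering `box` of the boxes. -/
noncomputable def xyMonomial (box : Fin n ≃ lam.cells) (c d : Fin n → ℕ) (T : Tableau lam n) :
    PolyXY n :=
  (∏ k : Fin n, X (Sum.inl (T (box k))) ^ c k) * ∏ k : Fin n, X (Sum.inr (T (box k))) ^ d k

/-- The polynomial `F_T^{c,d} = ε_T (x_T^c y_T^d)`, where the group algebra acts through the
diagonal action. -/
noncomputable def spechtPoly (box : Fin n ≃ lam.cells) (c d : Fin n → ℕ) (T : Tableau lam n) :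
    PolyXY n :=
  (diagonalAction n).asAlgebraHom T.youngSymmetrizer (T.xyMonomial box c d)

end Tableau

/-- `SYT(lam)`: the standard Young tableaux of shape `lam`. -/
abbrev SYT (lam : YoungDiagram) (n : ℕ) : Type := {T : Tableau lam n // T.IsStandard}

end HigherSpecht

/-! Young symmetrizers of distinct standard tableaux are triangular: ordering standard tableaux
lexicographically by the rows of their letters, `ε_S ε_T = 0` whenever `S < T`
(`youngSymmetrizer_mul_eq_zero`). Also `y ε_S² = ε_S` for some `y`
(`exists_mul_youngSymmetrizer_sq`). As `I` is stable under the group algebra, applying `y ε_S` to a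
relation, with `S` minimal in its support, leaves only a multiple of `F_S`; so the family is
independent once no member vanishes. Since `π F_T = F_{πT}`, one nonzero member makes all of them
nonzero. The converse only needs a standard tableau to exist. -/

namespace HigherSpecht

/-! ### Signed subgroup sums and a positive definite form -/

section SignedSum

variable {G : Type*} [Fintype G]

/-- The standard hermitian form on the group algebra. -/
noncomputable def groupForm (x y : MonoidAlgebra ℂ G) : ℂ :=
  ∑ g, x.coeff g * star (y.coeff g)

theorem eq_zero_of_groupForm_self {x : MonoidAlgebra ℂ G} (h : groupForm x x = 0) : x = 0 := by
  have h' : ∑ g, Complex.normSq (x.coeff g) = 0 := by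
    have : ((∑ g, Complex.normSq (x.coeff g) : ℝ) : ℂ) = 0 := by
      rw [← h]
      simp [groupForm, Complex.mul_conj]
    exact_mod_cast this
  rw [Finset.sum_eq_zero_iff_of_nonneg fun _ _ => Complex.normSq_nonneg _] at h'
  ext g
  simpa using h' g (Finset.mem_univ g)

theorem groupForm_zero_left (y : MonoidAlgebra ℂ G) : groupForm 0 y = 0 := by simp [groupForm]

theorem groupForm_smul_right (a : ℂ) (x y : MonoidAlgebra ℂ G) :
    groupForm x (a • y) = star a * groupForm x y := by
  simp [groupForm, Finset.mul_sum, mul_left_comm]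

theorem groupForm_smul_left (a : ℂ) (x y : MonoidAlgebra ℂ G) :
    groupForm (a • x) y = a * groupForm x y := by
  simp [groupForm, Finset.mul_sum, mul_assoc]

theorem groupForm_sum_left {ι : Type*} (s : Finset ι) (f : ι → MonoidAlgebra ℂ G)
    (y : MonoidAlgebra ℂ G) : groupForm (∑ i ∈ s, f i) y = ∑ i ∈ s, groupForm (f i) y := by
  simp only [groupForm, MonoidAlgebra.coeff_sum, Finsupp.finsetSum_apply, Finset.sum_mul]
  exact Finset.sum_comm

theorem groupForm_sum_right {ι : Type*} (s : Finset ι) (f : ι → MonoidAlgebra ℂ G)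
    (y : MonoidAlgebra ℂ G) : groupForm y (∑ i ∈ s, f i) = ∑ i ∈ s, groupForm y (f i) := by
  simp only [groupForm, MonoidAlgebra.coeff_sum, Finsupp.finsetSum_apply, star_sum, Finset.mul_sum]
  exact Finset.sum_comm

variable [Group G]

open Classical in
/-- The sum `∑_{h ∈ H} χ(h) h` in the group algebra. -/
noncomputable def signedSum (H : Subgroup G) (χ : G →* ℤˣ) : MonoidAlgebra ℂ G :=
  ∑ h : H, MonoidAlgebra.single (h : G) (((χ h : ℤˣ) : ℤ) : ℂ)

theorem units_int_cast_mul_self (u : ℤˣ) : (((u : ℤˣ) : ℤ) : ℂ) * ((u : ℤ) : ℂ) = 1 := by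
  rw [← Int.cast_mul, ← Units.val_mul, Int.units_mul_self]; simp

theorem single_mul_signedSum (H : Subgroup G) (χ : G →* ℤˣ) {h : G} (hh : h ∈ H) :
    MonoidAlgebra.single h 1 * signedSum H χ = (((χ h : ℤˣ) : ℤ) : ℂ) • signedSum H χ := by
  classical
  unfold signedSum
  rw [Finset.mul_sum, Finset.smul_sum]
  refine Fintype.sum_equiv (Equiv.mulLeft (⟨h, hh⟩ : H)) _ _ fun k => ?_
  rw [MonoidAlgebra.single_mul_single, MonoidAlgebra.smul_single]
  simp [← mul_assoc, units_int_cast_mul_self]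

theorem signedSum_mul_single (H : Subgroup G) (χ : G →* ℤˣ) {h : G} (hh : h ∈ H) :
    signedSum H χ * MonoidAlgebra.single h 1 = (((χ h : ℤˣ) : ℤ) : ℂ) • signedSum H χ := by
  classical
  unfold signedSum
  rw [Finset.sum_mul, Finset.smul_sum]
  refine Fintype.sum_equiv (Equiv.mulRight (⟨h, hh⟩ : H)) _ _ fun k => ?_
  rw [MonoidAlgebra.single_mul_single, MonoidAlgebra.smul_single]
  simp [mul_left_comm _ (((χ k : ℤˣ) : ℤ) : ℂ), units_int_cast_mul_self]

open Classical in
theorem signedSum_mul_self (H : Subgroup G) (χ : G →* ℤˣ) :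
    signedSum H χ * signedSum H χ = (Fintype.card H : ℂ) • signedSum H χ := by
  conv_lhs => enter [1]; unfold signedSum
  rw [Finset.sum_mul]
  have : ∀ h : H, MonoidAlgebra.single (h : G) (((χ h : ℤˣ) : ℤ) : ℂ) * signedSum H χ
      = signedSum H χ := by
    intro h
    have e : MonoidAlgebra.single (h : G) (((χ h : ℤˣ) : ℤ) : ℂ)
        = (((χ h : ℤˣ) : ℤ) : ℂ) • MonoidAlgebra.single (h : G) (1 : ℂ) := by simp
    rw [e, smul_mul_assoc, single_mul_signedSum H χ h.2, smul_smul, units_int_cast_mul_self,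
      one_smul]
  rw [Finset.sum_congr rfl fun h _ => this h]
  simp [← Nat.cast_smul_eq_nsmul ℂ]

/-- Two signed sums whose characters disagree on a common element multiply to zero. -/
theorem signedSum_mul_signedSum_eq_zero {H K : Subgroup G} {χ ψ : G →* ℤˣ} {t : G}
    (hH : t ∈ H) (hK : t ∈ K) (hχ : χ t = 1) (hψ : ψ t = -1) :
    signedSum H χ * signedSum K ψ = 0 := by
  have h1 := signedSum_mul_single H χ hH
  have h2 := single_mul_signedSum K ψ hK
  rw [hχ] at h1
  rw [hψ] at h2
  have h3 : signedSum H χ * signedSum K ψ = -(signedSum H χ * signedSum K ψ) := by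
    conv_lhs => rw [← one_smul ℂ (signedSum H χ)]
    simp only [Units.val_one, Int.cast_one, Units.val_neg, Int.cast_neg, neg_smul, one_smul]
      at h1 h2 ⊢
    conv_lhs => rw [← h1, mul_assoc, h2, mul_neg]
  have h4 : (2 : ℂ) • (signedSum H χ * signedSum K ψ) = 0 := by
    rw [two_smul]
    nth_rewrite 1 [h3]
    exact neg_add_cancel _
  exact (smul_eq_zero.mp h4).resolve_left two_ne_zero

theorem groupForm_mul_single (x y : MonoidAlgebra ℂ G) (g : G) (r : ℂ) :
    groupForm (x * MonoidAlgebra.single g r) y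
      = groupForm x (y * MonoidAlgebra.single g⁻¹ (star r)) := by
  unfold groupForm
  refine Fintype.sum_equiv (Equiv.mulRight g⁻¹) _ _ fun k => ?_
  simp
  ring

/-- Self-adjointness: inversion permutes `H`, and the sign `χ` is real with `χ h⁻¹ = χ h`. -/
theorem groupForm_mul_signedSum (H : Subgroup G) (χ : G →* ℤˣ) (x y : MonoidAlgebra ℂ G) :
    groupForm (x * signedSum H χ) y = groupForm x (y * signedSum H χ) := by
  classical
  unfold signedSum
  rw [Finset.mul_sum, Finset.mul_sum, groupForm_sum_left, groupForm_sum_right]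
  refine Fintype.sum_equiv (Equiv.inv H) _ _ fun k => ?_
  rw [groupForm_mul_single]
  simp

/-- `C` and `R` are self-adjoint and idempotent up to a nonzero scalar, so definiteness cancels
first the last `R` of `xCRCR`, then the last `C`. -/
theorem mul_signedSum_mul_signedSum_eq_zero (H K : Subgroup G) (χ ψ : G →* ℤˣ)
    {x : MonoidAlgebra ℂ G}
    (h : x * (signedSum H χ * signedSum K ψ) * (signedSum H χ * signedSum K ψ) = 0) :
    x * (signedSum H χ * signedSum K ψ) = 0 := by
  classical
  have hC := signedSum_mul_self H χ
  have hR := signedSum_mul_self K ψ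
  have hc : (Fintype.card H : ℂ) ≠ 0 := Nat.cast_ne_zero.mpr Fintype.card_ne_zero
  have hr : (Fintype.card K : ℂ) ≠ 0 := Nat.cast_ne_zero.mpr Fintype.card_ne_zero
  have aC := groupForm_mul_signedSum H χ
  have aR := groupForm_mul_signedSum K ψ
  set C := signedSum H χ
  set R := signedSum K ψ
  simp only [← mul_assoc] at h ⊢
  have h1 : x * C * R * C = 0 := by
    apply eq_zero_of_groupForm_self
    rw [← aC, mul_assoc _ C C, hC, mul_smul_comm, groupForm_smul_left, ← aR, h,
      groupForm_zero_left, mul_zero]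
  apply eq_zero_of_groupForm_self
  have h2 : groupForm (x * C * R) (x * C) = 0 := by
    have : (Fintype.card H : ℂ) * groupForm (x * C * R) (x * C) = 0 := by
      have e := groupForm_smul_right (Fintype.card H : ℂ) (x * C * R) (x * C)
      rw [← mul_smul_comm, ← hC, ← mul_assoc, ← aC, h1, groupForm_zero_left] at e
      simpa using e.symm
    exact (mul_eq_zero.mp this).resolve_left hc
  rw [← aR, mul_assoc _ R R, hR, mul_smul_comm, groupForm_smul_left, h2, mul_zero]

/-- `e = C R` lies in the left ideal generated by `e²`. -/
theorem exists_mul_signedSum_sq (H K : Subgroup G) (χ ψ : G →* ℤˣ) :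
    ∃ y : MonoidAlgebra ℂ G, y * ((signedSum H χ * signedSum K ψ) *
      (signedSum H χ * signedSum K ψ)) = signedSum H χ * signedSum K ψ := by
  have hinj := fun x => mul_signedSum_mul_signedSum_eq_zero H K χ ψ (x := x)
  set e := signedSum H χ * signedSum K ψ
  have : FiniteDimensional ℂ (MonoidAlgebra ℂ G) :=
    Module.Finite.equiv (MonoidAlgebra.coeffLinearEquiv (S := ℂ) (M := G) ℂ).symm
  let f := LinearMap.mulRight ℂ e
  let L := LinearMap.range f
  have hf : ∀ z ∈ L, f z ∈ L := fun z _ => ⟨z, rfl⟩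
  -- Right multiplication by `e` is injective on the finite-dimensional left ideal `ℂ[G] e`, hence
  -- onto, and so hits `e`.
  have hi : Function.Injective (f.restrict hf) := by
    rw [injective_iff_map_eq_zero]
    rintro ⟨_, x, rfl⟩ hx
    apply Subtype.ext
    exact hinj x (congrArg Subtype.val hx)
  obtain ⟨⟨_, y, rfl⟩, hy⟩ := LinearMap.injective_iff_surjective.mp hi ⟨e, 1, one_mul e⟩
  exact ⟨y, (mul_assoc y e e).symm.trans (congrArg Subtype.val hy)⟩

end SignedSum

theorem signedSum_mul_single_of_conj {G : Type*} [Fintype G] [Group G] {H K : Subgroup G}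
    (χ : G →* ℤˣ) {g : G} (h : ∀ k, g * k * g⁻¹ ∈ H ↔ k ∈ K) :
    signedSum H χ * MonoidAlgebra.single g 1 = MonoidAlgebra.single g 1 * signedSum K χ := by
  classical
  unfold signedSum
  rw [Finset.sum_mul, Finset.mul_sum]
  symm
  refine Fintype.sum_equiv
    ((MulAut.conj g).toEquiv.subtypeEquiv fun k => (h k).symm) _ _ fun k => ?_
  rw [MonoidAlgebra.single_mul_single, MonoidAlgebra.single_mul_single]
  simp [mul_right_comm (((χ g : ℤˣ) : ℤ) : ℂ), units_int_cast_mul_self]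

/-! ### Young symmetrizers of standard tableaux -/

namespace Tableau

variable {lam : YoungDiagram} {n : ℕ}

theorem youngSymmetrizer_eq (T : Tableau lam n) :
    T.youngSymmetrizer = signedSum T.colGroup Equiv.Perm.sign * signedSum T.rowGroup 1 := by
  classical
  unfold youngSymmetrizer signedSum
  rw [Finset.sum_mul_sum]
  refine Finset.sum_congr rfl fun τ _ => Finset.sum_congr rfl fun σ _ => ?_
  simp [MonoidAlgebra.single_mul_single]

theorem youngSymmetrizer_trans_mul_single (T : Tableau lam n) (π : Equiv.Perm (Fin n)) :
    youngSymmetrizer (T.trans π) * MonoidAlgebra.single π 1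
      = MonoidAlgebra.single π 1 * T.youngSymmetrizer := by
  have hr : ∀ k, π * k * π⁻¹ ∈ rowGroup (T.trans π) ↔ k ∈ T.rowGroup := by
    intro k
    change (∀ i, rowOf T (π.symm (π (k (π.symm i)))) = rowOf T (π.symm i)) ↔
      ∀ i, rowOf T (k i) = rowOf T i
    rw [π.symm.forall_congr_left]
    simp
  have hc : ∀ k, π * k * π⁻¹ ∈ colGroup (T.trans π) ↔ k ∈ T.colGroup := by
    intro k
    change (∀ i, colOf T (π.symm (π (k (π.symm i)))) = colOf T (π.symm i)) ↔
      ∀ i, colOf T (k i) = colOf T i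
    rw [π.symm.forall_congr_left]
    simp
  rw [youngSymmetrizer_eq, youngSymmetrizer_eq, mul_assoc, signedSum_mul_single_of_conj _ hr,
    ← mul_assoc, signedSum_mul_single_of_conj _ hc, mul_assoc]

theorem diagonalAction_xyMonomial (box : Fin n ≃ lam.cells) (c d : Fin n → ℕ) (T : Tableau lam n)
    (π : Equiv.Perm (Fin n)) :
    diagonalAction n π (T.xyMonomial box c d) = xyMonomial box c d (T.trans π) := by
  change rename _ _ = _
  simp [xyMonomial, map_prod]

theorem diagonalAction_spechtPoly (box : Fin n ≃ lam.cells) (c d : Fin n → ℕ) (T : Tableau lam n)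
    (π : Equiv.Perm (Fin n)) :
    diagonalAction n π (T.spechtPoly box c d) = spechtPoly box c d (T.trans π) := by
  unfold spechtPoly
  rw [← diagonalAction_xyMonomial, ← Representation.asAlgebraHom_single_one (diagonalAction n) π,
    ← Module.End.mul_apply, ← Module.End.mul_apply, ← map_mul, ← map_mul,
    youngSymmetrizer_trans_mul_single]

/-- If `i` were further left in `S` than in `T`, its box in `S` would hold in `T` a letter `j < i`;
by induction `j` has the same box in `S`, which `i` already occupies. -/
theorem symm_eq_of_rowOf_eq {S T : Tableau lam n} (hS : S.IsStandard) (hT : T.IsStandard)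
    (i : Fin n) (h : ∀ j ≤ i, S.rowOf j = T.rowOf j) : S.symm i = T.symm i := by
  induction i using WellFoundedLT.induction with
  | ind i ih =>
    have key : ∀ {S T : Tableau lam n}, T.IsStandard → S.rowOf i = T.rowOf i →
        (∀ j < i, S.symm j = T.symm j) → ¬ S.colOf i < T.colOf i := by
      intro S T hT hr ih hlt
      have hj : T (S.symm i) < i := by
        have := hT.1 (S.symm i) (T.symm i) hr hlt
        rwa [T.apply_symm_apply] at this
      have := ih _ hj
      rw [T.symm_apply_apply] at this
      exact hj.ne (S.symm.injective this)
    have ih' : ∀ j < i, S.symm j = T.symm j :=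
      fun j hj => ih j hj fun k hk => h k (hk.trans hj.le)
    have h1 := key hT (h i le_rfl) ih'
    have h2 := key hS (h i le_rfl).symm fun j hj => (ih' j hj).symm
    exact Subtype.ext (Prod.ext (h i le_rfl) (le_antisymm (not_lt.mp h2) (not_lt.mp h1)))

theorem exists_rowOf_eq_colOf_eq {S T : Tableau lam n} (hS : S.IsStandard) (hT : T.IsStandard)
    (h : toLex S.rowOf < toLex T.rowOf) :
    ∃ i j, i ≠ j ∧ S.rowOf i = S.rowOf j ∧ T.colOf i = T.colOf j := by
  obtain ⟨i, hlt, hi⟩ := h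
  change S.rowOf i < T.rowOf i at hi
  -- This box lies above `i` in `T`, so its letter in `T` is smaller than `i` and has the same box
  -- in `S`.
  have hmem : (S.rowOf i, T.colOf i) ∈ lam.cells :=
    lam.isLowerSet ⟨hi.le, le_rfl⟩ (T.symm i).2
  have hj : T ⟨_, hmem⟩ < i := by
    have := hT.2 ⟨_, hmem⟩ (T.symm i) rfl hi
    rwa [T.apply_symm_apply] at this
  refine ⟨i, T ⟨_, hmem⟩, hj.ne', ?_, ?_⟩
  · have := symm_eq_of_rowOf_eq hS hT (T ⟨_, hmem⟩) fun k hk => hlt k (hk.trans_lt hj)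
    exact (congrArg (fun b : lam.cells => (b : ℕ × ℕ).1)
      (this.trans (T.symm_apply_apply _))).symm
  · simp [colOf]

theorem swap_mem_rowGroup {T : Tableau lam n} {i j : Fin n} (h : T.rowOf i = T.rowOf j) :
    Equiv.swap i j ∈ T.rowGroup := by
  intro k
  by_cases h1 : k = i
  · subst h1; rw [Equiv.swap_apply_left, h]
  by_cases h2 : k = j
  · subst h2; rw [Equiv.swap_apply_right, h]
  rw [Equiv.swap_apply_of_ne_of_ne h1 h2]

theorem swap_mem_colGroup {T : Tableau lam n} {i j : Fin n} (h : T.colOf i = T.colOf j) :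
    Equiv.swap i j ∈ T.colGroup := by
  intro k
  by_cases h1 : k = i
  · subst h1; rw [Equiv.swap_apply_left, h]
  by_cases h2 : k = j
  · subst h2; rw [Equiv.swap_apply_right, h]
  rw [Equiv.swap_apply_of_ne_of_ne h1 h2]

/-- A transposition in both `R(S)` and `C(T)` forces the middle product of the row sum of `S` and
the column sum of `T` to vanish. -/
theorem youngSymmetrizer_mul_eq_zero {S T : Tableau lam n} (hS : S.IsStandard)
    (hT : T.IsStandard) (h : toLex S.rowOf < toLex T.rowOf) :
    S.youngSymmetrizer * T.youngSymmetrizer = 0 := by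
  obtain ⟨i, j, hij, hr, hc⟩ := exists_rowOf_eq_colOf_eq hS hT h
  rw [youngSymmetrizer_eq, youngSymmetrizer_eq, mul_assoc,
    ← mul_assoc (signedSum S.rowGroup 1),
    signedSum_mul_signedSum_eq_zero (swap_mem_rowGroup hr) (swap_mem_colGroup hc) rfl
      (Equiv.Perm.sign_swap hij), zero_mul, mul_zero]

theorem exists_mul_youngSymmetrizer_sq (T : Tableau lam n) :
    ∃ y, y * (T.youngSymmetrizer * T.youngSymmetrizer) = T.youngSymmetrizer := by
  rw [youngSymmetrizer_eq]
  exact exists_mul_signedSum_sq ..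

end Tableau

/-- Numbering the boxes row by row gives a standard tableau. -/
theorem nonempty_SYT {lam : YoungDiagram} {n : ℕ} (box : Fin n ≃ lam.cells) :
    Nonempty (SYT lam n) := by
  let key : lam.cells → ℕ ×ₗ ℕ := fun b => toLex b.1
  have hkey : Function.Injective key := fun a b h => Subtype.ext (toLex.injective h)
  let r := Equiv.ofInjective key hkey
  let _ : Fintype (Set.range key) := Fintype.ofEquiv _ r
  let e := Fintype.orderIsoFinOfCardEq (Set.range key)
    (by rw [← Fintype.card_congr (box.trans r), Fintype.card_fin])
  have he : ∀ b b' : lam.cells, key b < key b' → e.symm (r b) < e.symm (r b') :=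
    fun b b' h => e.symm.lt_iff_lt.mpr h
  exact ⟨⟨r.trans e.symm.toEquiv,
    fun b b' h1 h2 => he b b' (Prod.Lex.toLex_lt_toLex.mpr (Or.inr ⟨h1, h2⟩)),
    fun b b' _ h2 => he b b' (Prod.Lex.toLex_lt_toLex.mpr (Or.inl h2))⟩⟩

theorem asAlgebraHom_mem {n : ℕ} {I : Ideal (PolyXY n)}
    (hI : ∀ π : Equiv.Perm (Fin n), ∀ f ∈ I, diagonalAction n π f ∈ I)
    (a : MonoidAlgebra ℂ (Equiv.Perm (Fin n))) {f : PolyXY n} (hf : f ∈ I) :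
    (diagonalAction n).asAlgebraHom a f ∈ I := by
  rw [← MonoidAlgebra.sum_coeff_single a, Finsupp.sum, map_sum, LinearMap.sum_apply]
  refine I.sum_mem fun π _ => ?_
  rw [Representation.asAlgebraHom_single, LinearMap.smul_apply, MvPolynomial.smul_eq_C_mul]
  exact I.mul_mem_left _ (hI π f hf)

end HigherSpecht

/-! ### Linear independence modulo an invariant ideal -/

open HigherSpecht Tableau in
theorem linearIndependent_spechtPoly {n : ℕ} {lam : YoungDiagram} (box : Fin n ≃ lam.cells)
    (c d : Fin n → ℕ) (I : Ideal (PolyXY n))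
    (hI : ∀ π : Equiv.Perm (Fin n), ∀ f ∈ I, diagonalAction n π f ∈ I)
    (hF : ∀ T : SYT lam n, T.1.spechtPoly box c d ∉ I) :
    LinearIndependent ℂ (fun T : SYT lam n => Ideal.Quotient.mk I (T.1.spechtPoly box c d)) := by
  classical
  rw [linearIndependent_iff']
  intro s a hs
  by_contra! hne
  obtain ⟨T₀, hT₀, ha₀⟩ := hne
  obtain ⟨S, hS, hmin⟩ := (s.filter fun T => a T ≠ 0).exists_min_image
    (fun T => toLex T.1.rowOf) ⟨T₀, Finset.mem_filter.mpr ⟨hT₀, ha₀⟩⟩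
  obtain ⟨hSs, haS⟩ := Finset.mem_filter.mp hS
  have hmem : ∑ T ∈ s, a T • T.1.spechtPoly box c d ∈ I := by
    rw [← Ideal.Quotient.eq_zero_iff_mem, map_sum, ← hs]
    rfl
  obtain ⟨y, hy⟩ := exists_mul_youngSymmetrizer_sq S.1
  -- By triangularity and minimality of `S`, only the term of `S` survives, and there `y ε_S ε_S =
  -- ε_S`.
  have h := asAlgebraHom_mem hI (y * S.1.youngSymmetrizer) hmem
  rw [map_sum, Finset.sum_eq_single_of_mem S hSs] at h
  · rw [map_smul, spechtPoly, ← Module.End.mul_apply, ← map_mul, mul_assoc, hy,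
      MvPolynomial.smul_eq_C_mul] at h
    refine hF S ?_
    have := I.mul_mem_left (C (a S)⁻¹) h
    rwa [← mul_assoc, ← C_mul, inv_mul_cancel₀ haS, C_1, one_mul] at this
  · intro T hT hTS
    by_cases haT : a T = 0
    · rw [haT, zero_smul, map_zero]
    have hle := hmin T (Finset.mem_filter.mpr ⟨hT, haT⟩)
    have hlt : toLex S.1.rowOf < toLex T.1.rowOf := by
      refine lt_of_le_of_ne hle fun he => hTS (Subtype.ext ?_)
      have he' : S.1.rowOf = T.1.rowOf := toLex.injective he
      refine Equiv.symm_bijective.injective (Equiv.ext fun i => ?_)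
      exact symm_eq_of_rowOf_eq T.2 S.2 i fun j _ => congrFun he'.symm j
    rw [map_smul, spechtPoly, ← Module.End.mul_apply, ← map_mul, mul_assoc,
      youngSymmetrizer_mul_eq_zero S.2 T.2 hlt, mul_zero, map_zero, LinearMap.zero_apply,
      smul_zero]

/-- `lam` is a partition of `n`, given by its Young diagram, and `box` is the fixed ordering of its
`n` boxes. -/
theorem proposition3p5 (n : ℕ) (lam : YoungDiagram) (box : Fin n ≃ lam.cells) (c d : Fin n → ℕ)
    (I : Ideal (HigherSpecht.PolyXY n))
    (hI : ∀ π : Equiv.Perm (Fin n), ∀ f ∈ I, HigherSpecht.diagonalAction n π f ∈ I) :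
    LinearIndependent ℂ (fun T : HigherSpecht.SYT lam n =>
        Ideal.Quotient.mk I (HigherSpecht.Tableau.spechtPoly box c d T.1)) ↔
      ∃ T : HigherSpecht.SYT lam n,
        Ideal.Quotient.mk I (HigherSpecht.Tableau.spechtPoly box c d T.1) ≠ 0 := by
  constructor
  · intro h
    obtain ⟨T⟩ := HigherSpecht.nonempty_SYT box
    exact ⟨T, h.ne_zero T⟩
  · rintro ⟨T, hT⟩
    refine linearIndependent_spechtPoly box c d I hI fun S hS => hT ?_
    rw [Ideal.Quotient.eq_zero_iff_mem]
    -- The permutation carrying `S` to `T` would bring `F_T` into `I` along with `F_S`.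
    have h := hI (S.1.symm.trans T.1) _ hS
    rw [HigherSpecht.Tableau.diagonalAction_spechtPoly] at h
    have e : S.1.trans (S.1.symm.trans T.1) = T.1 := by ext; simp
    rwa [e] at h
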